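/- Rings are associative and not necessarily unital. A ring $R \neq 0$ with center $Z(R)$ is prime if $aRb=0$ implies $a=0$ or $b=0$ for all $a,b\in R$. For subsets $A,B$ of a ring, $AB$ denotes the additive subgroup generated by all products $ab$ with $a\in A$, $b\in B$. A Lie ideal of $R$ is an additive subgroup $L$ with $xr-rx\in L$ for all $x\in L$, $r\in R$; it is noncentral if $L\not\subseteq Z(R)$. For a prime ring $R$ let $Q_s(R)\supseteq R$ be its symmetric Martindale ring of quotients, and let the extended centroid $C$ be the center of $Q_s(R)$. \textbf{Proposition.} Let $R$ be a prime ring with noncentral Lie ideals $K$ and $L$. Then $KL$ contains a nonzero (two-sided) ideal of $R$, except precisely when $KC=LC=Ca+C$ for some $a\in L$; that is, $KL$ contains a nonzero ideal of $R$ if and only if there is no $a\in L$ with $KC=LC=Ca+C$ (an equality of additive subgroups of $Q_s(R)$). -/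

import Mathlib

/-- A (not necessarily unital) ring is prime if `aRb = 0` implies `a = 0` or `b = 0`. -/
class IsPrimeRing (R : Type*) [NonUnitalRing R] : Prop where
  eq_zero_or_eq_zero : ∀ a b : R, (∀ r : R, a * r * b = 0) → a = 0 ∨ b = 0

/-- A Lie ideal is an additive subgroup `L` with `[L, R] ⊆ L`. -/
def IsLieIdeal {R : Type*} [NonUnitalRing R] (L : AddSubgroup R) : Prop :=
  ∀ x ∈ L, ∀ r : R, x * r - r * x ∈ L

/-- The product `AB` of two subsets: the additive subgroup generated by all `a * b`,
`a ∈ A`, `b ∈ B`. -/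
def addProd {S : Type*} [NonUnitalRing S] (A B : Set S) : AddSubgroup S :=
  AddSubgroup.closure (Set.image2 (fun a b => a * b) A B)

/-- The additive subgroup `A` contains a nonzero (two-sided) ideal of `R`. -/
def ContainsNonzeroIdeal {R : Type*} [NonUnitalRing R] (A : AddSubgroup R) : Prop :=
  ∃ I : TwoSidedIdeal R, I ≠ ⊥ ∧ (I : Set R) ⊆ (A : Set R)

namespace Martindale

section NonzeroIdeals

variable {R : Type*} [NonUnitalRing R]

theorem exists_ne_zero {I : TwoSidedIdeal R} (h : I ≠ ⊥) : ∃ x ∈ I, x ≠ 0 := by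
  by_contra! hc
  refine h (TwoSidedIdeal.ext fun x => ?_)
  rw [TwoSidedIdeal.mem_bot]
  exact ⟨hc x, fun hx => hx ▸ I.zero_mem⟩

theorem ne_bot_of_mem {I : TwoSidedIdeal R} {x : R} (hx : x ∈ I) (h : x ≠ 0) : I ≠ ⊥ := by
  rintro rfl
  exact h ((TwoSidedIdeal.mem_bot R).1 hx)

theorem exists_mul_ne_zero [IsPrimeRing R] {I J : TwoSidedIdeal R} (hI : I ≠ ⊥) (hJ : J ≠ ⊥) :
    ∃ x ∈ I, ∃ y ∈ J, x * y ≠ 0 := by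
  obtain ⟨a, ha, ha0⟩ := exists_ne_zero hI
  obtain ⟨b, hb, hb0⟩ := exists_ne_zero hJ
  by_contra! hc
  exact (IsPrimeRing.eq_zero_or_eq_zero a b fun r =>
    hc _ (I.mul_mem_right _ _ ha) _ hb).elim ha0 hb0

theorem inf_ne_bot [IsPrimeRing R] {I J : TwoSidedIdeal R} (hI : I ≠ ⊥) (hJ : J ≠ ⊥) :
    I ⊓ J ≠ ⊥ := by
  obtain ⟨x, hx, y, hy, h⟩ := exists_mul_ne_zero hI hJ
  exact ne_bot_of_mem
    ((TwoSidedIdeal.mem_inf R).2 ⟨I.mul_mem_right _ _ hx, J.mul_mem_left _ _ hy⟩) h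

theorem top_ne_bot [Nontrivial R] : (⊤ : TwoSidedIdeal R) ≠ ⊥ := by
  obtain ⟨x, hx⟩ := exists_ne (0 : R)
  exact ne_bot_of_mem (TwoSidedIdeal.mem_top R) hx

end NonzeroIdeals

/-- A homomorphism of right `R`-modules `f : J → R` defined on a nonzero two-sided ideal `J`
of `R`. It is represented by a total function, of which only the values on `J` matter. -/
structure PartialHom (R : Type*) [NonUnitalRing R] where
  dom : TwoSidedIdeal R
  dom_ne_bot : dom ≠ ⊥
  toFun : R → R
  map_add' : ∀ x ∈ dom, ∀ y ∈ dom, toFun (x + y) = toFun x + toFun y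
  map_mul' : ∀ x ∈ dom, ∀ r : R, toFun (x * r) = toFun x * r

namespace PartialHom

section Basic

variable {R : Type*} [NonUnitalRing R]

theorem map_zero' (f : PartialHom R) : f.toFun 0 = 0 := by
  have h := f.map_mul' 0 f.dom.zero_mem 0
  simpa using h

theorem map_neg' (f : PartialHom R) {x : R} (hx : x ∈ f.dom) : f.toFun (-x) = -f.toFun x := by
  have h := f.map_add' x hx (-x) (f.dom.neg_mem hx)
  rw [add_neg_cancel, f.map_zero'] at h
  exact (neg_eq_of_add_eq_zero_right h.symm).symm

/-- The largest two-sided ideal inside `{x ∈ dom f | f x ∈ I}`. -/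
def pull (f : PartialHom R) (I : TwoSidedIdeal R) : TwoSidedIdeal R :=
  TwoSidedIdeal.mk' {x | x ∈ f.dom ∧ f.toFun x ∈ I ∧ ∀ r : R, f.toFun (r * x) ∈ I}
    ⟨f.dom.zero_mem, by rw [f.map_zero']; exact I.zero_mem,
      fun r => by rw [mul_zero, f.map_zero']; exact I.zero_mem⟩
    (by
      rintro x y ⟨hx, hx1, hx2⟩ ⟨hy, hy1, hy2⟩
      refine ⟨f.dom.add_mem hx hy, ?_, fun r => ?_⟩
      · rw [f.map_add' x hx y hy]
        exact I.add_mem hx1 hy1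
      · rw [mul_add, f.map_add' _ (f.dom.mul_mem_left _ _ hx) _ (f.dom.mul_mem_left _ _ hy)]
        exact I.add_mem (hx2 r) (hy2 r))
    (by
      rintro x ⟨hx, hx1, hx2⟩
      refine ⟨f.dom.neg_mem hx, ?_, fun r => ?_⟩
      · rw [f.map_neg' hx]
        exact I.neg_mem hx1
      · rw [mul_neg, f.map_neg' (f.dom.mul_mem_left _ _ hx)]
        exact I.neg_mem (hx2 r))
    (by
      rintro x y ⟨hy, hy1, hy2⟩
      exact ⟨f.dom.mul_mem_left _ _ hy, hy2 x, fun r => by rw [← mul_assoc]; exact hy2 _⟩)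
    (by
      rintro x y ⟨hx, hx1, hx2⟩
      refine ⟨f.dom.mul_mem_right _ _ hx, ?_, fun r => ?_⟩
      · rw [f.map_mul' x hx]
        exact I.mul_mem_right _ _ hx1
      · rw [← mul_assoc, f.map_mul' _ (f.dom.mul_mem_left _ _ hx)]
        exact I.mul_mem_right _ _ (hx2 r))

theorem mem_pull {f : PartialHom R} {I : TwoSidedIdeal R} {x : R} :
    x ∈ f.pull I ↔ x ∈ f.dom ∧ f.toFun x ∈ I ∧ ∀ r : R, f.toFun (r * x) ∈ I :=
  TwoSidedIdeal.mem_mk' _ _ _ _ _ _ x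

theorem pull_ne_bot [IsPrimeRing R] (f : PartialHom R) {I : TwoSidedIdeal R} (hI : I ≠ ⊥) :
    f.pull I ≠ ⊥ := by
  obtain ⟨x, hx, y, hy, h⟩ := exists_mul_ne_zero f.dom_ne_bot hI
  refine ne_bot_of_mem (mem_pull.2 ⟨f.dom.mul_mem_right _ _ hx, ?_, fun r => ?_⟩) h
  · rw [f.map_mul' x hx]
    exact I.mul_mem_left _ _ hy
  · rw [← mul_assoc, f.map_mul' _ (f.dom.mul_mem_left _ _ hx)]
    exact I.mul_mem_left _ _ hy

/-- Left multiplication by `a`, defined on all of `R`. -/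
def ofElem [Nontrivial R] (a : R) : PartialHom R where
  dom := ⊤
  dom_ne_bot := top_ne_bot
  toFun x := a * x
  map_add' x _ y _ := mul_add a x y
  map_mul' x _ r := (mul_assoc a x r).symm

/-- The identity map of `R`. -/
def one [Nontrivial R] : PartialHom R where
  dom := ⊤
  dom_ne_bot := top_ne_bot
  toFun x := x
  map_add' _ _ _ _ := rfl
  map_mul' _ _ _ := rfl

/-- The zero map of `R`. -/
def zero [Nontrivial R] : PartialHom R where
  dom := ⊤
  dom_ne_bot := top_ne_bot
  toFun _ := 0
  map_add' _ _ _ _ := (add_zero 0).symm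
  map_mul' _ _ r := (zero_mul r).symm

/-- The pointwise negative. -/
def neg (f : PartialHom R) : PartialHom R where
  dom := f.dom
  dom_ne_bot := f.dom_ne_bot
  toFun x := -f.toFun x
  map_add' x hx y hy := by rw [f.map_add' x hx y hy, neg_add]
  map_mul' x hx r := by rw [f.map_mul' x hx r, neg_mul]

variable [IsPrimeRing R]

/-- The pointwise sum, defined on the intersection of the domains. -/
def add (f g : PartialHom R) : PartialHom R where
  dom := f.dom ⊓ g.dom
  dom_ne_bot := inf_ne_bot f.dom_ne_bot g.dom_ne_bot
  toFun x := f.toFun x + g.toFun x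
  map_add' x hx y hy := by
    rw [TwoSidedIdeal.mem_inf] at hx hy
    rw [f.map_add' x hx.1 y hy.1, g.map_add' x hx.2 y hy.2]
    exact add_add_add_comm _ _ _ _
  map_mul' x hx r := by
    rw [TwoSidedIdeal.mem_inf] at hx
    rw [f.map_mul' x hx.1, g.map_mul' x hx.2, add_mul]

/-- The composition `f ∘ g`. -/
def mul (f g : PartialHom R) : PartialHom R where
  dom := g.pull f.dom
  dom_ne_bot := g.pull_ne_bot f.dom_ne_bot
  toFun x := f.toFun (g.toFun x)
  map_add' x hx y hy := by
    rw [mem_pull] at hx hy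
    rw [g.map_add' x hx.1 y hy.1, f.map_add' _ hx.2.1 _ hy.2.1]
  map_mul' x hx r := by
    rw [mem_pull] at hx
    rw [g.map_mul' x hx.1, f.map_mul' _ hx.2.1]

/-- Two partial homomorphisms are identified if they agree on a nonzero ideal contained in
both domains. -/
instance setoid (R : Type*) [NonUnitalRing R] [IsPrimeRing R] : Setoid (PartialHom R) where
  r f g := ∃ I : TwoSidedIdeal R, I ≠ ⊥ ∧ I ≤ f.dom ∧ I ≤ g.dom ∧ ∀ x ∈ I, f.toFun x = g.toFun x
  iseqv :=
    { refl := fun f => ⟨f.dom, f.dom_ne_bot, le_rfl, le_rfl, fun _ _ => rfl⟩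
      symm := fun ⟨I, h, h1, h2, h3⟩ => ⟨I, h, h2, h1, fun x hx => (h3 x hx).symm⟩
      trans := fun ⟨I, h, h1, _, h3⟩ ⟨J, k, _, k2, k3⟩ =>
        ⟨I ⊓ J, inf_ne_bot h k, inf_le_left.trans h1, inf_le_right.trans k2, fun x hx =>
          (h3 x ((TwoSidedIdeal.mem_inf R).1 hx).1).trans (k3 x ((TwoSidedIdeal.mem_inf R).1 hx).2)⟩ }

theorem equiv_iff {f g : PartialHom R} : f ≈ g ↔ ∃ I : TwoSidedIdeal R,
    I ≠ ⊥ ∧ I ≤ f.dom ∧ I ≤ g.dom ∧ ∀ x ∈ I, f.toFun x = g.toFun x :=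
  Iff.rfl

theorem equiv_of_agree {f g : PartialHom R} {I : TwoSidedIdeal R} (hI : I ≠ ⊥)
    (h : ∀ x ∈ I, x ∈ f.dom → x ∈ g.dom → f.toFun x = g.toFun x) : f ≈ g := by
  refine ⟨I ⊓ (f.dom ⊓ g.dom), inf_ne_bot hI (inf_ne_bot f.dom_ne_bot g.dom_ne_bot),
    inf_le_right.trans inf_le_left, inf_le_right.trans inf_le_right, fun x hx => ?_⟩
  simp only [TwoSidedIdeal.mem_inf] at hx
  exact h x hx.1 hx.2.1 hx.2.2

theorem equiv_of_agree_dom {f g : PartialHom R}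
    (h : ∀ x, x ∈ f.dom → x ∈ g.dom → f.toFun x = g.toFun x) : f ≈ g :=
  equiv_of_agree f.dom_ne_bot fun x _ => h x

end Basic

end PartialHom

section RightQuotients

variable (R : Type*) [NonUnitalRing R] [IsPrimeRing R]

/-- The right Martindale ring of quotients of a prime ring `R`: partial right module
homomorphisms on nonzero ideals, up to agreement on a nonzero ideal, with pointwise addition
and with composition as the product. -/
def RightQuotient : Type _ := Quotient (PartialHom.setoid R)

variable {R}

namespace RightQuotient

open PartialHom

/-- The class of a partial homomorphism. -/
def mk (f : PartialHom R) : RightQuotient R := Quotient.mk _ f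

theorem mk_eq_mk {f g : PartialHom R} : mk f = mk g ↔ f ≈ g := Quotient.eq

theorem ind {p : RightQuotient R → Prop} (h : ∀ f, p (mk f)) (q : RightQuotient R) : p q :=
  Quotient.inductionOn q h

instance : Add (RightQuotient R) where
  add := Quotient.map₂ PartialHom.add (by
    rintro f f' ⟨I, hI, _, _, hf⟩ g g' ⟨J, hJ, _, _, hg⟩
    refine equiv_of_agree (inf_ne_bot hI hJ) fun x hx _ _ => ?_
    rw [TwoSidedIdeal.mem_inf] at hx
    exact congrArg₂ (· + ·) (hf x hx.1) (hg x hx.2))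

instance : Mul (RightQuotient R) where
  mul := Quotient.map₂ PartialHom.mul (by
    rintro f f' ⟨I, hI, _, _, hf⟩ g g' ⟨J, hJ, _, _, hg⟩
    refine equiv_of_agree (inf_ne_bot hJ (g.pull_ne_bot hI)) fun x hx _ _ => ?_
    rw [TwoSidedIdeal.mem_inf, mem_pull] at hx
    exact (hf _ hx.2.2.1).trans (congrArg f'.toFun (hg x hx.1)))

instance : Neg (RightQuotient R) where
  neg := Quotient.map PartialHom.neg (by
    rintro f f' ⟨I, hI, _, _, hf⟩
    exact equiv_of_agree hI fun x hx _ _ => congrArg (- ·) (hf x hx))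

theorem mk_add (f g : PartialHom R) : mk f + mk g = mk (f.add g) := rfl

theorem mk_mul (f g : PartialHom R) : mk f * mk g = mk (f.mul g) := rfl

theorem mk_neg (f : PartialHom R) : -mk f = mk f.neg := rfl

variable [Nontrivial R]

instance : Zero (RightQuotient R) where
  zero := mk PartialHom.zero

instance : One (RightQuotient R) where
  one := mk PartialHom.one

theorem zero_def : (0 : RightQuotient R) = mk PartialHom.zero := rfl

theorem one_def : (1 : RightQuotient R) = mk PartialHom.one := rfl

instance : Ring (RightQuotient R) where
  add_assoc := by
    refine ind fun f => ind fun g => ind fun h => ?_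
    exact mk_eq_mk.2 (equiv_of_agree_dom fun x _ _ => add_assoc _ _ _)
  zero_add := by
    refine ind fun f => ?_
    exact mk_eq_mk.2 (equiv_of_agree_dom fun x _ _ => zero_add _)
  add_zero := by
    refine ind fun f => ?_
    exact mk_eq_mk.2 (equiv_of_agree_dom fun x _ _ => add_zero _)
  add_comm := by
    refine ind fun f => ind fun g => ?_
    exact mk_eq_mk.2 (equiv_of_agree_dom fun x _ _ => add_comm _ _)
  neg_add_cancel := by
    refine ind fun f => ?_
    exact mk_eq_mk.2 (equiv_of_agree_dom fun x _ _ => neg_add_cancel _)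
  mul_assoc := by
    refine ind fun f => ind fun g => ind fun h => ?_
    exact mk_eq_mk.2 (equiv_of_agree_dom fun x _ _ => rfl)
  one_mul := by
    refine ind fun f => ?_
    exact mk_eq_mk.2 (equiv_of_agree_dom fun x _ _ => rfl)
  mul_one := by
    refine ind fun f => ?_
    exact mk_eq_mk.2 (equiv_of_agree_dom fun x _ _ => rfl)
  zero_mul := by
    refine ind fun f => ?_
    exact mk_eq_mk.2 (equiv_of_agree_dom fun x _ _ => rfl)
  mul_zero := by
    refine ind fun f => ?_
    exact mk_eq_mk.2 (equiv_of_agree_dom fun x _ _ => f.map_zero')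
  left_distrib := by
    refine ind fun f => ind fun g => ind fun h => ?_
    refine mk_eq_mk.2 (equiv_of_agree_dom fun x _ hx => ?_)
    obtain ⟨h1, h2⟩ := (TwoSidedIdeal.mem_inf R).1 hx
    exact f.map_add' _ (mem_pull.1 h1).2.1 _ (mem_pull.1 h2).2.1
  right_distrib := by
    refine ind fun f => ind fun g => ind fun h => ?_
    exact mk_eq_mk.2 (equiv_of_agree_dom fun x _ _ => rfl)
  nsmul := nsmulRec
  zsmul := zsmulRec

/-- The canonical map `R → Q_r(R)`, sending `a` to left multiplication by `a`. -/
def ofRing : R →ₙ+* RightQuotient R where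
  toFun a := mk (PartialHom.ofElem a)
  map_mul' a b := mk_eq_mk.2 (equiv_of_agree_dom fun x _ _ => mul_assoc a b x)
  map_zero' := mk_eq_mk.2 (equiv_of_agree_dom fun x _ _ => zero_mul x)
  map_add' a b := mk_eq_mk.2 (equiv_of_agree_dom fun x _ _ => add_mul a b x)

theorem ofRing_injective : Function.Injective (ofRing (R := R)) := by
  refine (injective_iff_map_eq_zero _).2 fun a ha => ?_
  obtain ⟨I, hI, _, _, h⟩ := mk_eq_mk.1 ha
  obtain ⟨b, hb, hb0⟩ := exists_ne_zero hI
  refine (IsPrimeRing.eq_zero_or_eq_zero a b fun r => ?_).resolve_right hb0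
  rw [mul_assoc]
  exact h (r * b) (I.mul_mem_left _ _ hb)

end RightQuotient

end RightQuotients

section SymmetricQuotients

variable (R : Type*) [NonUnitalRing R] [IsPrimeRing R] [Nontrivial R]

open RightQuotient

/-- The symmetric Martindale ring of quotients, as the subring
`{q | Jq ⊆ R for some nonzero ideal J of R}` of the right Martindale ring of quotients. -/
def symmetricQuotient : Subring (RightQuotient R) where
  carrier := {q | ∃ J : TwoSidedIdeal R, J ≠ ⊥ ∧ ∀ x ∈ J, ∃ y : R, ofRing x * q = ofRing y}
  zero_mem' := ⟨⊤, top_ne_bot, fun x _ => ⟨0, by rw [mul_zero, map_zero]⟩⟩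
  one_mem' := ⟨⊤, top_ne_bot, fun x _ => ⟨x, mul_one _⟩⟩
  add_mem' := by
    rintro p q ⟨I, hI, hp⟩ ⟨J, hJ, hq⟩
    refine ⟨I ⊓ J, inf_ne_bot hI hJ, fun x hx => ?_⟩
    rw [TwoSidedIdeal.mem_inf] at hx
    obtain ⟨y, hy⟩ := hp x hx.1
    obtain ⟨z, hz⟩ := hq x hx.2
    exact ⟨y + z, by rw [mul_add, hy, hz, map_add]⟩
  neg_mem' := by
    rintro p ⟨I, hI, hp⟩
    refine ⟨I, hI, fun x hx => ?_⟩
    obtain ⟨y, hy⟩ := hp x hx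
    exact ⟨-y, by rw [mul_neg, hy, map_neg]⟩
  mul_mem' := by
    rintro p q ⟨I, hI, hp⟩ ⟨J, hJ, hq⟩
    obtain ⟨a, ha, b, hb, hab⟩ := exists_mul_ne_zero hJ hI
    refine ⟨TwoSidedIdeal.mk' {x | (∃ y ∈ J, ofRing x * p = ofRing y) ∧
        ∀ r : R, ∃ y ∈ J, ofRing (x * r) * p = ofRing y} ?_ ?_ ?_ ?_ ?_, ?_, ?_⟩
    · exact ⟨⟨0, J.zero_mem, by rw [map_zero, zero_mul]⟩,
        fun r => ⟨0, J.zero_mem, by rw [zero_mul, map_zero, zero_mul]⟩⟩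
    · rintro x y ⟨⟨u, hu, hxu⟩, hx⟩ ⟨⟨v, hv, hyv⟩, hy⟩
      refine ⟨⟨u + v, J.add_mem hu hv, by rw [map_add, add_mul, hxu, hyv, map_add]⟩, fun r => ?_⟩
      obtain ⟨s, hs, hs'⟩ := hx r
      obtain ⟨t, ht, ht'⟩ := hy r
      exact ⟨s + t, J.add_mem hs ht, by rw [add_mul, map_add, add_mul, hs', ht', map_add]⟩
    · rintro x ⟨⟨u, hu, hxu⟩, hx⟩
      refine ⟨⟨-u, J.neg_mem hu, by rw [map_neg, neg_mul, hxu, map_neg]⟩, fun r => ?_⟩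
      obtain ⟨s, hs, hs'⟩ := hx r
      exact ⟨-s, J.neg_mem hs, by rw [neg_mul, map_neg, neg_mul, hs', map_neg]⟩
    · rintro x y ⟨⟨u, hu, hyu⟩, hy⟩
      refine ⟨⟨x * u, J.mul_mem_left _ _ hu, by rw [map_mul, mul_assoc, hyu, map_mul]⟩,
        fun r => ?_⟩
      obtain ⟨s, hs, hs'⟩ := hy r
      exact ⟨x * s, J.mul_mem_left _ _ hs, by rw [mul_assoc, map_mul, mul_assoc, hs', map_mul]⟩
    · rintro x y ⟨-, hx⟩
      exact ⟨hx y, fun r => by rw [mul_assoc]; exact hx _⟩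
    · refine ne_bot_of_mem (x := a * b) ((TwoSidedIdeal.mem_mk' _ _ _ _ _ _ _).2
        ⟨?_, fun r => ?_⟩) hab
      · obtain ⟨y, hy⟩ := hp b hb
        exact ⟨a * y, J.mul_mem_right _ _ ha, by rw [map_mul, mul_assoc, hy, map_mul]⟩
      · obtain ⟨y, hy⟩ := hp (b * r) (I.mul_mem_right _ _ hb)
        exact ⟨a * y, J.mul_mem_right _ _ ha,
          by rw [mul_assoc, map_mul, mul_assoc, hy, map_mul]⟩
    · intro x hx
      obtain ⟨⟨y, hy, hxy⟩, -⟩ := (TwoSidedIdeal.mem_mk' _ _ _ _ _ _ _).1 hx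
      obtain ⟨z, hz⟩ := hq y hy
      exact ⟨z, by rw [← mul_assoc, hxy, hz]⟩

/-- The symmetric Martindale ring of quotients `Q_s(R)`, as a type. -/
abbrev Qs : Type _ := symmetricQuotient R

/-- The canonical embedding `R → Q_s(R)`. -/
def toQs : R →ₙ+* Qs R where
  toFun a := ⟨ofRing a, ⊤, top_ne_bot, fun x _ => ⟨x * a, (map_mul ofRing x a).symm⟩⟩
  map_mul' a b := Subtype.ext (map_mul ofRing a b)
  map_zero' := Subtype.ext (map_zero ofRing)
  map_add' a b := Subtype.ext (map_add ofRing a b)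

theorem toQs_injective : Function.Injective (toQs R) := fun _ _ h =>
  ofRing_injective (congrArg Subtype.val h)

/-- The extended centroid `C` of `R`: the center of `Q_s(R)`. -/
def extendedCentroid : Subring (Qs R) := Subring.center (Qs R)

variable {R}

/-- `AC`: the additive subgroup of `Q_s(R)` generated by all `a * c`, `a ∈ A`, `c ∈ C`. -/
def centroidSpan (A : Set R) : AddSubgroup (Qs R) :=
  addProd (toQs R '' A) (extendedCentroid R : Set (Qs R))

/-- `Ca + C`, an additive subgroup of `Q_s(R)`. -/
def centroidLine (a : R) : AddSubgroup (Qs R) :=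
  addProd (extendedCentroid R : Set (Qs R)) {toQs R a} ⊔ (extendedCentroid R).toAddSubgroup

end SymmetricQuotients

end Martindale

/-! Suppose `KL` contains no nonzero ideal. Since `KL` is a Lie ideal, it contains neither `Rx` nor
`xR` for any `x ≠ 0`. Now `[k,rl]l' - [k,rl']l - [k,r][l,l'] = r([k,l]l' - [k,l']l)` lies in `KL`
for every `r`, so `[k,l]l' = [k,l']l`; likewise `k[l,k'] = k'[l,k]`. Putting `l' = [l,x]` and `k' =
[k,x]` gives identities `∑ aᵢ x bᵢ = 0` in a free variable `x`. Martindale's lemma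
(`eq_zero_of_sum_mul_mul_eq_zero`) turns such an identity into linear relations `∑ f(bᵢ) aᵢ = 0` and
`∑ f(aᵢ) bᵢ = 0` over the field `C`, for every functional `f`. If `l` is noncentral and `k ∉ Cl +
C`, they force `kl = 0` (`mul_eq_zero_of_notMem_span`), then `Kl = 0`, and finally `kRl = 0`,
against primeness. So `K ⊆ Cl + C` for each noncentral `l ∈ L`. Exchange gives `L ⊆ Cl + C` too, and
`exists_commutator_notMem_span` supplies the scalar 1, so both spans equal `Cl + C`. Conversely, if
both spans are `Ca + C`, then `a` commutes with all of `KL`. An ideal inside `KL` would make `a`,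
and hence `L`, central. -/

namespace Martindale

/-! ### Multiplying elements of the quotient rings into `R`, and proportionality over `C` -/

namespace RightQuotient

open PartialHom

variable {R : Type*} [NonUnitalRing R] [IsPrimeRing R] [Nontrivial R]

theorem mk_mul_ofRing (f : PartialHom R) {x : R} (hx : x ∈ f.dom) :
    mk f * ofRing x = ofRing (f.toFun x) :=
  mk_eq_mk.2 (equiv_of_agree_dom fun y _ _ => f.map_mul' x hx y)

theorem eq_zero_of_mul_ofRing {p : RightQuotient R} {I : TwoSidedIdeal R} (hI : I ≠ ⊥)
    (h : ∀ x ∈ I, p * ofRing x = 0) : p = 0 := by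
  induction p using ind with
  | h f =>
    refine mk_eq_mk.2 (equiv_of_agree hI fun x hx hxf _ => ?_)
    have := h x hx
    rw [mk_mul_ofRing f hxf, ← map_zero (ofRing (R := R))] at this
    exact ofRing_injective this

end RightQuotient

section Qs

open RightQuotient

variable {R : Type*} [NonUnitalRing R] [IsPrimeRing R] [Nontrivial R]

omit [Nontrivial R] in
theorem mul_eq_zero_of_ideal {I : TwoSidedIdeal R} (hI : I ≠ ⊥) {a b : R}
    (h : ∀ x ∈ I, a * x * b = 0) : a = 0 ∨ b = 0 := by
  obtain ⟨x, hx, hx0⟩ := exists_ne_zero hI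
  by_cases ha : a = 0
  · exact Or.inl ha
  refine Or.inr ((IsPrimeRing.eq_zero_or_eq_zero x b fun s => ?_).resolve_left hx0)
  refine (IsPrimeRing.eq_zero_or_eq_zero a _ fun r => ?_).resolve_left ha
  have := h (r * (x * s)) (I.mul_mem_left _ _ (I.mul_mem_right _ _ hx))
  simpa only [mul_assoc] using this

theorem exists_toQs_mul_eq (q : Qs R) :
    ∃ J : TwoSidedIdeal R, J ≠ ⊥ ∧ ∀ x ∈ J, ∃ y, toQs R x * q = toQs R y := by
  obtain ⟨J, hJ, h⟩ := q.2
  refine ⟨J, hJ, fun x hx => ?_⟩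
  obtain ⟨y, hy⟩ := h x hx
  exact ⟨y, Subtype.ext hy⟩

theorem exists_mul_toQs_eq (q : Qs R) :
    ∃ J : TwoSidedIdeal R, J ≠ ⊥ ∧ ∀ x ∈ J, ∃ y, q * toQs R x = toQs R y := by
  obtain ⟨p, hp⟩ := q
  induction p using RightQuotient.ind with
  | h f => exact ⟨f.dom, f.dom_ne_bot, fun x hx => ⟨f.toFun x, Subtype.ext (mk_mul_ofRing f hx)⟩⟩

theorem eq_zero_of_mul_toQs {p : Qs R} {I : TwoSidedIdeal R} (hI : I ≠ ⊥)
    (h : ∀ x ∈ I, p * toQs R x = 0) : p = 0 :=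
  Subtype.ext (eq_zero_of_mul_ofRing hI fun x hx => congrArg Subtype.val (h x hx))

theorem toQs_eq_zero {a : R} : toQs R a = 0 ↔ a = 0 :=
  map_eq_zero_iff _ (toQs_injective R)

theorem eq_zero_of_toQs_mul {p : Qs R} {I : TwoSidedIdeal R} (hI : I ≠ ⊥)
    (h : ∀ x ∈ I, toQs R x * p = 0) : p = 0 := by
  obtain ⟨J, hJ, hJp⟩ := exists_mul_toQs_eq p
  refine eq_zero_of_mul_toQs hJ fun z hz => ?_
  obtain ⟨y, hy⟩ := hJp z hz
  obtain ⟨x, hx, hx0⟩ := exists_ne_zero hI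
  rw [hy, toQs_eq_zero]
  refine (IsPrimeRing.eq_zero_or_eq_zero x y fun r => ?_).resolve_left hx0
  rw [← toQs_eq_zero, map_mul, ← hy, ← mul_assoc, h _ (I.mul_mem_right _ _ hx), zero_mul]

/-- Primeness passes to `Q_s(R)`: `p` and `q` are multiplied into `R` by ideals on the outer sides,
which reduces the claim to elements of `R`. -/
theorem eq_zero_or_eq_zero_of_ideal {p q : Qs R} {J : TwoSidedIdeal R} (hJ : J ≠ ⊥)
    (h : ∀ y ∈ J, p * toQs R y * q = 0) : p = 0 ∨ q = 0 := by
  by_contra! hpq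
  obtain ⟨I, hI, hIp⟩ := exists_mul_toQs_eq p
  obtain ⟨I', hI', hIq⟩ := exists_toQs_mul_eq q
  refine hpq.1 (eq_zero_of_mul_toQs hI fun x hx => ?_)
  by_contra hx0
  refine hpq.2 (eq_zero_of_toQs_mul hI' fun y hy => ?_)
  obtain ⟨u, hu⟩ := hIp x hx
  obtain ⟨v, hv⟩ := hIq y hy
  rw [hv, toQs_eq_zero]
  refine (mul_eq_zero_of_ideal hJ (a := u) fun z hz => ?_).resolve_left fun h0 =>
    hx0 (by rw [hu, h0, map_zero])
  have := h (x * z * y) (J.mul_mem_right _ _ (J.mul_mem_left _ _ hz))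
  rw [← toQs_eq_zero, map_mul, map_mul, ← hu, ← hv, ← this]
  simp only [map_mul, mul_assoc]

theorem eq_zero_or_eq_zero_of_toQs {p q : Qs R} (h : ∀ y, p * toQs R y * q = 0) :
    p = 0 ∨ q = 0 :=
  eq_zero_or_eq_zero_of_ideal top_ne_bot fun y _ => h y

theorem commute_of_commute_toQs {p : Qs R} (h : ∀ r, toQs R r * p = p * toQs R r) :
    p ∈ extendedCentroid R := by
  refine Subring.mem_center_iff.2 fun q => ?_
  obtain ⟨J, hJ, hJq⟩ := exists_toQs_mul_eq q
  rw [← sub_eq_zero]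
  refine eq_zero_of_toQs_mul hJ fun x hx => ?_
  obtain ⟨y, hy⟩ := hJq x hx
  rw [mul_sub, ← mul_assoc, ← mul_assoc, hy, h x, mul_assoc, hy, h y, sub_self]

/-- The ideal of all `z : R` for which some `t : R` satisfies `t r a = z r b` for all `r ∈ J`. -/
def ratioIdeal (a b : Qs R) (J : TwoSidedIdeal R) : TwoSidedIdeal R :=
  TwoSidedIdeal.mk' {z | ∃ t, ∀ r ∈ J, toQs R t * toQs R r * a = toQs R z * toQs R r * b}
    ⟨0, fun r _ => by simp only [map_zero, zero_mul]⟩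
    (by
      rintro x y ⟨t, ht⟩ ⟨u, hu⟩
      exact ⟨t + u, fun r hr => by simp only [map_add, add_mul, ht r hr, hu r hr]⟩)
    (by
      rintro x ⟨t, ht⟩
      exact ⟨-t, fun r hr => by simp only [map_neg, neg_mul, ht r hr]⟩)
    (by
      rintro x y ⟨t, ht⟩
      exact ⟨x * t, fun r hr => by
        simpa only [map_mul, mul_assoc] using congrArg (toQs R x * ·) (ht r hr)⟩)
    (by
      rintro x y ⟨t, ht⟩
      exact ⟨t * y, fun r hr => by
        simpa only [map_mul, mul_assoc] using ht (y * r) (J.mul_mem_left _ _ hr)⟩)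

theorem mem_ratioIdeal {a b : Qs R} {J : TwoSidedIdeal R} {z : R} : z ∈ ratioIdeal a b J ↔
    ∃ t, ∀ r ∈ J, toQs R t * toQs R r * a = toQs R z * toQs R r * b :=
  TwoSidedIdeal.mem_mk' _ _ _ _ _ _ z

theorem ratioIdeal_ne_bot {a b : Qs R} (ha : a ≠ 0) {J : TwoSidedIdeal R}
    (h : ∀ y ∈ J, a * toQs R y * b = b * toQs R y * a) : ratioIdeal a b J ≠ ⊥ := by
  obtain ⟨I, hI, hIa⟩ := exists_toQs_mul_eq a
  obtain ⟨I', hI', hIb⟩ := exists_toQs_mul_eq b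
  by_contra hbot
  refine ha (eq_zero_of_toQs_mul (inf_ne_bot hI hI') fun x hx => ?_)
  rw [TwoSidedIdeal.mem_inf] at hx
  obtain ⟨z, hz⟩ := hIa x hx.1
  obtain ⟨t, ht⟩ := hIb x hx.2
  rw [hz, toQs_eq_zero, ← TwoSidedIdeal.mem_bot R, ← hbot]
  refine mem_ratioIdeal.2 ⟨t, fun r hr => ?_⟩
  rw [← hz, ← ht, mul_assoc, mul_assoc, mul_assoc, mul_assoc, ← mul_assoc b, ← mul_assoc a,
    h r hr]

/-- The scalar is the "quotient" `b/a`: it sends `z = xa` to `t = xb`, and `t r a = z r b` follows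
from the hypothesis. This map `z ↦ t` commutes with multiplication on both sides, so its class is
central. -/
theorem exists_smul_eq_of_ideal {a b : Qs R} (ha : a ≠ 0) {J : TwoSidedIdeal R} (hJ : J ≠ ⊥)
    (h : ∀ y ∈ J, a * toQs R y * b = b * toQs R y * a) :
    ∃ c ∈ extendedCentroid R, b = c * a := by
  -- Only values on the ideal matter; 0 is a filler elsewhere.
  have hex : ∀ z, ∃ t, z ∈ ratioIdeal a b J →
      ∀ r ∈ J, toQs R t * toQs R r * a = toQs R z * toQs R r * b := fun z => by
    by_cases hz : z ∈ ratioIdeal a b J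
    · obtain ⟨t, ht⟩ := mem_ratioIdeal.1 hz
      exact ⟨t, fun _ => ht⟩
    · exact ⟨0, fun hz' => absurd hz' hz⟩
  choose g hg using hex
  have huniq : ∀ {t u : R}, (∀ r ∈ J, toQs R t * toQs R r * a = toQs R u * toQs R r * a) →
      t = u := fun {t u} htu => by
    rw [← sub_eq_zero, ← toQs_eq_zero]
    refine (eq_zero_or_eq_zero_of_ideal hJ fun r hr => ?_).resolve_right ha
    rw [map_sub, sub_mul, sub_mul, htu r hr, sub_self]
  let f : PartialHom R :=
    { dom := ratioIdeal a b J
      dom_ne_bot := ratioIdeal_ne_bot ha h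
      toFun := g
      map_add' := fun x hx y hy => huniq fun r hr => by
        rw [hg _ (TwoSidedIdeal.add_mem _ hx hy) r hr, map_add, map_add, add_mul, add_mul, add_mul,
          add_mul, hg x hx r hr, hg y hy r hr]
      map_mul' := fun x hx s => huniq fun r hr => by
        have := hg x hx (s * r) (J.mul_mem_left _ _ hr)
        rw [hg _ (TwoSidedIdeal.mul_mem_right _ _ _ hx) r hr]
        simpa only [map_mul, mul_assoc] using this.symm }
  have hspec : ∀ z ∈ f.dom, ∀ r ∈ J, toQs R (f.toFun z) * toQs R r * a = toQs R z * toQs R r * b :=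
    hg
  have hleft : ∀ z ∈ f.dom, ∀ s, f.toFun (s * z) = s * f.toFun z := fun z hz s =>
    huniq fun r hr => by
      rw [hspec _ (f.dom.mul_mem_left _ _ hz) r hr, map_mul, map_mul]
      simpa only [mul_assoc] using congrArg (toQs R s * ·) (hspec z hz r hr).symm
  have hcomm : ∀ s, ofRing s * mk f = mk f * ofRing s := fun s => by
    rw [← sub_eq_zero]
    refine eq_zero_of_mul_ofRing f.dom_ne_bot fun z hz => ?_
    rw [sub_mul, mul_assoc, mul_assoc, mk_mul_ofRing f hz, ← map_mul, ← map_mul,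
      mk_mul_ofRing f (f.dom.mul_mem_left _ _ hz), hleft z hz, sub_self]
  -- The class lies in the symmetric ring because `x * c = c * x = f x` is in `R` for `x` in the
  -- domain.
  let c : Qs R := ⟨mk f, f.dom, f.dom_ne_bot, fun x hx =>
    ⟨f.toFun x, by rw [hcomm, mk_mul_ofRing f hx]⟩⟩
  have hc : ∀ z ∈ f.dom, c * toQs R z = toQs R (f.toFun z) := fun z hz =>
    Subtype.ext (mk_mul_ofRing f hz)
  have hcR : ∀ s, toQs R s * c = c * toQs R s := fun s => Subtype.ext (hcomm s)
  refine ⟨c, commute_of_commute_toQs hcR, ?_⟩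
  rw [← sub_eq_zero]
  obtain ⟨z, hz, hz0⟩ := exists_ne_zero f.dom_ne_bot
  refine (eq_zero_or_eq_zero_of_ideal hJ (p := toQs R z) fun r hr => ?_).resolve_left
    (toQs_eq_zero.not.2 hz0)
  rw [mul_sub, sub_eq_zero, ← hspec z hz r hr, ← hc z hz, ← mul_assoc _ c a, ← map_mul, hcR,
    map_mul, mul_assoc c]

end Qs
end Martindale

/-! ### The extended centroid as a field, and Martindale's lemma -/

namespace Martindale

section Centroid

variable {R : Type*} [NonUnitalRing R] [IsPrimeRing R] [Nontrivial R]

theorem extendedCentroid_comm (c : extendedCentroid R) (q : Qs R) : (c : Qs R) * q = q * c :=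
  (Subring.mem_center_iff.1 c.2 q).symm

instance : Nontrivial (Qs R) := (toQs_injective R).nontrivial

/-- A central `c ≠ 0` satisfies `c y 1 = 1 y c`, so proportionality writes 1 as a multiple of `c`.
-/
theorem exists_extendedCentroid_inverse {c : extendedCentroid R} (hc : c ≠ 0) :
    ∃ d : extendedCentroid R, c * d = 1 := by
  obtain ⟨d, hd, h⟩ := exists_smul_eq_of_ideal (a := (c : Qs R)) (b := 1)
    (fun h => hc (Subtype.ext h)) (top_ne_bot (R := R)) fun y _ => by
      rw [mul_one, one_mul, extendedCentroid_comm]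
  exact ⟨⟨d, hd⟩, Subtype.ext (by rw [Subring.coe_mul, extendedCentroid_comm]; exact h.symm)⟩

open Classical in
noncomputable instance : Field (extendedCentroid R) where
  mul_comm a b := Subtype.ext (extendedCentroid_comm a b)
  inv c := if hc : c ≠ 0 then (exists_extendedCentroid_inverse hc).choose else 0
  exists_pair_ne := ⟨0, 1, zero_ne_one⟩
  mul_inv_cancel c hc := by
    change c * (if hc : c ≠ 0 then (exists_extendedCentroid_inverse hc).choose else 0) = 1
    rw [dif_pos hc]
    exact (exists_extendedCentroid_inverse hc).choose_spec
  inv_zero := dif_neg (not_not.2 rfl)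
  nnqsmul := _
  qsmul := _

noncomputable instance : Algebra (extendedCentroid R) (Qs R) :=
  Algebra.ofModule (fun c x y => mul_assoc (c : Qs R) x y) fun c x y => by
    change x * (c * y) = c * (x * y)
    rw [← mul_assoc, ← extendedCentroid_comm, mul_assoc]

theorem exists_smul_eq {a b : Qs R} (ha : a ≠ 0) {J : TwoSidedIdeal R} (hJ : J ≠ ⊥)
    (h : ∀ y ∈ J, a * toQs R y * b = b * toQs R y * a) :
    ∃ c : extendedCentroid R, b = c • a := by
  obtain ⟨c, hc, h⟩ := exists_smul_eq_of_ideal ha hJ h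
  exact ⟨⟨c, hc⟩, h⟩

/-- Martindale's lemma: linear generalized polynomial identities with independent
right coefficients are trivial. -/
theorem eq_zero_of_sum_mul_mul_eq_zero {ι : Type*} {e : ι → Qs R}
    (he : LinearIndependent (extendedCentroid R) e) (s : Finset ι) (b : ι → Qs R)
    (h : ∀ x, ∑ i ∈ s, b i * toQs R x * e i = 0) : ∀ i ∈ s, b i = 0 := by
  classical
  induction s using Finset.induction_on generalizing b with
  | empty => simp
  | insert j s hj ih =>
    suffices hbj : b j = 0 by
      intro i hi
      rcases Finset.mem_insert.1 hi with rfl | hi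
      · exact hbj
      · refine ih b (fun x => ?_) i hi
        have := h x
        rwa [Finset.sum_insert hj, hbj, zero_mul, zero_mul, zero_add] at this
    by_contra hbj
    obtain ⟨J, hJ, hJb⟩ := exists_toQs_mul_eq (b j)
    -- Compare the identity multiplied on the left by `b j * y` with the identity at `(y * b j) *
    -- x`, where `y * b j` lies in `R`. In the difference the `j` term cancels, so induction gives
    -- `b j * y * b i = b i * y * b j`.
    have hcomm : ∀ i ∈ s, ∃ c : extendedCentroid R, b i = c • b j := by
      intro i hi
      refine exists_smul_eq hbj hJ fun y hy => ?_
      rw [← sub_eq_zero]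
      refine ih (fun i => b j * toQs R y * b i - b i * toQs R y * b j) (fun x => ?_) i hi
      obtain ⟨z, hz⟩ := hJb y hy
      have h1 : ∑ i ∈ insert j s, b j * toQs R y * (b i * toQs R x * e i) = 0 := by
        rw [← Finset.mul_sum, h, mul_zero]
      have h2 := h (z * x)
      have h3 : ∑ i ∈ insert j s, (b j * toQs R y * b i - b i * toQs R y * b j) * toQs R x * e i
          = 0 := by
        rw [← sub_zero (0 : Qs R)]
        nth_rw 1 [← h1]
        rw [← h2, ← Finset.sum_sub_distrib]
        refine Finset.sum_congr rfl fun i _ => ?_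
        rw [map_mul, ← hz]
        noncomm_ring
      rwa [Finset.sum_insert hj, sub_self, zero_mul, zero_mul, zero_add] at h3
    have hcomm' : ∀ i, ∃ c : extendedCentroid R, i ∈ insert j s → b i = c • b j ∧ (i = j → c = 1) := by
      intro i
      by_cases hij : i = j
      · exact ⟨1, fun _ => ⟨by rw [hij, one_smul], fun _ => rfl⟩⟩
      by_cases hi : i ∈ s
      · obtain ⟨c, hc⟩ := hcomm i hi
        exact ⟨c, fun _ => ⟨hc, fun h => absurd h hij⟩⟩
      · exact ⟨0, fun h => absurd h (by simp [hij, hi])⟩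
    choose c hc using hcomm'
    -- With `b i = c i • b j` the identity reads `b j * x * ∑ c i • e i = 0`, while `c j = 1`.
    have h0 : ∑ i ∈ insert j s, c i • e i = 0 := by
      refine (eq_zero_or_eq_zero_of_toQs (p := b j) fun x => ?_).resolve_left hbj
      rw [Finset.mul_sum, ← h x]
      refine Finset.sum_congr rfl fun i hi => ?_
      rw [(hc i hi).1, mul_smul_comm, smul_mul_assoc, smul_mul_assoc]
    have := linearIndependent_iff'.1 he _ c h0 j (Finset.mem_insert_self _ _)
    rw [(hc j (Finset.mem_insert_self _ _)).2 rfl] at this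
    exact one_ne_zero this

/-- Basis-free form of Martindale's lemma: expand the `b i` in a basis; every coordinate sum of the
`a i` vanishes, and `f` takes a combination of these. -/
theorem sum_apply_right_smul_eq_zero {ι : Type*} [Fintype ι] (a b : ι → Qs R)
    (h : ∀ x, ∑ i, a i * toQs R x * b i = 0) (f : Qs R →ₗ[extendedCentroid R] extendedCentroid R) :
    ∑ i, f (b i) • a i = 0 := by
  classical
  let B := Module.Basis.ofVectorSpace (extendedCentroid R) (Qs R)
  let s := Finset.univ.biUnion fun i => (B.repr (b i)).support
  have hb : ∀ i, b i = ∑ j ∈ s, B.repr (b i) j • B j := fun i => by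
    conv_lhs => rw [← B.linearCombination_repr (b i)]
    rw [Finsupp.linearCombination_apply]
    exact Finsupp.sum_of_support_subset _
      (Finset.subset_biUnion_of_mem (fun i => (B.repr (b i)).support) (Finset.mem_univ i)) _
      fun _ _ => zero_smul _ _
  have hcoef := eq_zero_of_sum_mul_mul_eq_zero B.linearIndependent s
    (fun j => ∑ i, B.repr (b i) j • a i) fun x => by
      rw [← h x]
      conv_rhs =>
        enter [2, i]
        rw [hb i, Finset.mul_sum]
      rw [Finset.sum_comm]
      refine Finset.sum_congr rfl fun j _ => ?_
      rw [Finset.sum_mul, Finset.sum_mul]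
      refine Finset.sum_congr rfl fun i _ => ?_
      rw [smul_mul_assoc, smul_mul_assoc, mul_smul_comm]
  have : ∀ i, f (b i) • a i = ∑ j ∈ s, f (B j) • B.repr (b i) j • a i := fun i => by
    conv_lhs => rw [hb i]
    rw [map_sum, Finset.sum_smul]
    refine Finset.sum_congr rfl fun j _ => ?_
    rw [map_smul, smul_eq_mul, mul_comm, mul_smul]
  simp_rw [this]
  rw [Finset.sum_comm]
  refine Finset.sum_eq_zero fun j hj => ?_
  rw [← Finset.smul_sum, hcoef j hj, smul_zero]

/-- Follows by duality: `∑ f (a i) g (b i) = 0` for every functional `g`, and functionals separate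
points. -/
theorem sum_apply_left_smul_eq_zero {ι : Type*} [Fintype ι] (a b : ι → Qs R)
    (h : ∀ x, ∑ i, a i * toQs R x * b i = 0) (f : Qs R →ₗ[extendedCentroid R] extendedCentroid R) :
    ∑ i, f (a i) • b i = 0 := by
  by_contra hne
  obtain ⟨g, hg, -⟩ := Submodule.exists_le_ker_of_notMem
    (p := (⊥ : Submodule (extendedCentroid R) (Qs R))) (by rwa [Submodule.mem_bot])
  refine hg ?_
  have := congrArg f (sum_apply_right_smul_eq_zero a b h g)
  rw [map_sum, map_zero] at this
  rw [map_sum, ← this]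
  refine Finset.sum_congr rfl fun i _ => ?_
  rw [map_smul, map_smul, smul_eq_mul, smul_eq_mul, mul_comm]

end Centroid
end Martindale

/-! ### Products of Lie ideals and the commutator identities -/

section LieIdeals

variable {R : Type*} [NonUnitalRing R]

theorem mul_mem_addProd {A B : Set R} {a b : R} (ha : a ∈ A) (hb : b ∈ B) :
    a * b ∈ addProd A B :=
  AddSubgroup.subset_closure ⟨a, ha, b, hb, rfl⟩

theorem addProd_le {A B : Set R} {M : AddSubgroup R} (h : ∀ a ∈ A, ∀ b ∈ B, a * b ∈ M) :
    addProd A B ≤ M := by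
  refine (AddSubgroup.closure_le _).2 ?_
  rintro _ ⟨a, ha, b, hb, rfl⟩
  exact h a ha b hb

theorem IsLieIdeal.addProd {K L : AddSubgroup R} (hK : IsLieIdeal K) (hL : IsLieIdeal L) :
    IsLieIdeal (addProd (K : Set R) (L : Set R)) := by
  intro x hx r
  induction hx using AddSubgroup.closure_induction with
  | mem x hx =>
    obtain ⟨k, hk, l, hl, rfl⟩ := hx
    have := add_mem (mul_mem_addProd hk (hL l hl r)) (mul_mem_addProd (hK k hk r) hl)
    convert this using 1
    noncomm_ring
  | zero => simp
  | add x y _ _ hx hy =>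
    convert add_mem hx hy using 1
    noncomm_ring
  | neg x _ hx =>
    convert neg_mem hx using 1
    noncomm_ring

variable [IsPrimeRing R]

theorem exists_mul_mul_ne_zero {x : R} (hx : x ≠ 0) : ∃ r s : R, r * x * s ≠ 0 := by
  by_contra! h
  have hxs : ∀ s, x * s = 0 := fun s => by
    refine (IsPrimeRing.eq_zero_or_eq_zero x (x * s) fun r => ?_).resolve_left hx
    rw [mul_assoc, ← mul_assoc r, h, mul_zero]
  exact hx ((IsPrimeRing.eq_zero_or_eq_zero x x fun r => by rw [hxs, zero_mul]).elim id id)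

theorem containsNonzeroIdeal_of_mul_mul_mem {M : AddSubgroup R} {x : R} (hx : x ≠ 0)
    (h : ∀ r s, r * x * s ∈ M) : ContainsNonzeroIdeal M := by
  obtain ⟨r, s, hrs⟩ := exists_mul_mul_ne_zero hx
  -- Without a unit, `z`, `Rz`, `zR` and `RzR` must each be required to lie in `M`.
  refine ⟨TwoSidedIdeal.mk' {z | z ∈ M ∧ (∀ r, r * z ∈ M) ∧ (∀ s, z * s ∈ M) ∧
    ∀ r s, r * z * s ∈ M} ?_ ?_ ?_ ?_ ?_, Martindale.ne_bot_of_mem (x := r * x * s) ?_ hrs,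
    fun z hz => ?_⟩
  · simp [M.zero_mem]
  · rintro x y ⟨hx, hx1, hx2, hx3⟩ ⟨hy, hy1, hy2, hy3⟩
    simp only [Set.mem_ofPred_eq, mul_add, add_mul]
    exact ⟨M.add_mem hx hy, fun r => M.add_mem (hx1 r) (hy1 r), fun r => M.add_mem (hx2 r) (hy2 r),
      fun r s => M.add_mem (hx3 r s) (hy3 r s)⟩
  · rintro x ⟨hx, hx1, hx2, hx3⟩
    simp only [Set.mem_ofPred_eq, mul_neg, neg_mul]
    exact ⟨M.neg_mem hx, fun r => M.neg_mem (hx1 r), fun r => M.neg_mem (hx2 r),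
      fun r s => M.neg_mem (hx3 r s)⟩
  · rintro t z ⟨-, hz1, -, hz3⟩
    exact ⟨hz1 t, fun r => by rw [← mul_assoc]; exact hz1 _, hz3 t,
      fun r s => by rw [← mul_assoc]; exact hz3 _ _⟩
  · rintro z t ⟨-, -, hz2, hz3⟩
    exact ⟨hz2 t, fun r => by rw [← mul_assoc]; exact hz3 _ _,
      fun r => by rw [mul_assoc]; exact hz2 _,
      fun r s => by rw [← mul_assoc, mul_assoc (r * z)]; exact hz3 _ _⟩
  · refine (TwoSidedIdeal.mem_mk' _ _ _ _ _ _ _).2 ⟨h r s, fun t => ?_, fun t => ?_, fun t u => ?_⟩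
    · simpa only [mul_assoc] using h (t * r) s
    · simpa only [mul_assoc] using h r (s * t)
    · simpa only [mul_assoc] using h (t * r) (s * u)
  · exact ((TwoSidedIdeal.mem_mk' _ _ _ _ _ _ _).1 hz).1

theorem IsLieIdeal.containsNonzeroIdeal_of_mul_left_mem {M : AddSubgroup R} (hM : IsLieIdeal M)
    {x : R} (hx : x ≠ 0) (h : ∀ r, r * x ∈ M) : ContainsNonzeroIdeal M := by
  refine containsNonzeroIdeal_of_mul_mul_mem hx fun r s => ?_
  convert M.add_mem (hM _ (h r) s) (h (s * r)) using 1
  noncomm_ring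

theorem IsLieIdeal.containsNonzeroIdeal_of_mul_right_mem {M : AddSubgroup R} (hM : IsLieIdeal M)
    {x : R} (hx : x ≠ 0) (h : ∀ r, x * r ∈ M) : ContainsNonzeroIdeal M := by
  refine containsNonzeroIdeal_of_mul_mul_mem hx fun r s => ?_
  convert M.sub_mem (h (s * r)) (hM _ (h s) r) using 1
  noncomm_ring

section NoIdeal

variable {K L : AddSubgroup R} (hK : IsLieIdeal K) (hL : IsLieIdeal L)
  (hKL : ¬ ContainsNonzeroIdeal (addProd (K : Set R) (L : Set R)))

include hK hL hKL

theorem commutator_mul_eq_commutator_mul {k l l' : R} (hk : k ∈ K) (hl : l ∈ L) (hl' : l' ∈ L) :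
    (k * l - l * k) * l' = (k * l' - l' * k) * l := by
  by_contra hne
  refine hKL ((hK.addProd hL).containsNonzeroIdeal_of_mul_left_mem (sub_ne_zero.2 hne) fun r => ?_)
  convert sub_mem (sub_mem (mul_mem_addProd (hK k hk (r * l)) hl')
    (mul_mem_addProd (hK k hk (r * l')) hl)) (mul_mem_addProd (hK k hk r) (hL l hl l')) using 1
  noncomm_ring

theorem mul_commutator_eq_mul_commutator {k k' l : R} (hk : k ∈ K) (hk' : k' ∈ K) (hl : l ∈ L) :
    k * (l * k' - k' * l) = k' * (l * k - k * l) := by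
  by_contra hne
  refine hKL ((hK.addProd hL).containsNonzeroIdeal_of_mul_right_mem (sub_ne_zero.2 hne) fun r => ?_)
  convert sub_mem (sub_mem (mul_mem_addProd hk (hL l hl (k' * r)))
    (mul_mem_addProd hk' (hL l hl (k * r)))) (mul_mem_addProd (hK k hk k') (hL l hl r)) using 1
  noncomm_ring

end NoIdeal

end LieIdeals

/-! ### Without an ideal in `KL`, `K` lies in `Cl + C` -/

namespace Martindale

section Main

variable {R : Type*} [NonUnitalRing R] [IsPrimeRing R] [Nontrivial R]

local notation "C" => extendedCentroid R

open Submodule in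
theorem coeff_eq_zero {x y : Qs R} (hy : y ∉ span C {1}) (hx : x ∉ span C {y, 1})
    {α β γ : C} (h : α • x + β • y + γ • (1 : Qs R) = 0) : α = 0 ∧ β = 0 := by
  obtain ⟨f, hf, hfk⟩ := exists_le_ker_of_notMem hx
  obtain ⟨g, hg, hgk⟩ := exists_le_ker_of_notMem hy
  have hfy : f y = 0 := hfk (subset_span (by simp))
  have hf1 : f 1 = 0 := hfk (subset_span (by simp))
  have hg1 : g 1 = 0 := hgk (subset_span (by simp))
  have h1 := congrArg f h
  simp only [map_add, map_smul, hfy, hf1, smul_eq_mul, mul_zero, add_zero, map_zero] at h1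
  have hα : α = 0 := (mul_eq_zero.1 h1).resolve_right hf
  have h2 := congrArg g h
  simp only [hα, zero_smul, zero_add, map_add, map_smul, hg1, smul_eq_mul,
    mul_zero, add_zero, map_zero] at h2
  exact ⟨hα, (mul_eq_zero.1 h2).resolve_right hg⟩

open Submodule in
theorem notMem_span_one {a : R} (ha : a ∉ Set.center R) : toQs R a ∉ span C {1} := by
  intro h
  obtain ⟨c, hc⟩ := mem_span_singleton.1 h
  refine ha (Semigroup.mem_center_iff.2 fun r => toQs_injective R ?_)
  rw [map_mul, map_mul, ← hc, mul_smul_comm, smul_mul_assoc, one_mul, mul_one]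

section NoIdeal

variable {K L : AddSubgroup R} (hK : IsLieIdeal K) (hL : IsLieIdeal L)
  (hKL : ¬ ContainsNonzeroIdeal (addProd (K : Set R) (L : Set R)))

include hK hL hKL

open Submodule in
theorem mul_mem_span_right {k l : R} (hk : k ∈ K) (hl : l ∈ L)
    (hl1 : toQs R l ∉ span C {1}) (hkl : toQs R k ∉ span C {toQs R l, 1}) :
    toQs R l * toQs R l ∈ span C {toQs R l, 1} ∧ toQs R k * toQs R l ∈ span C {toQs R l, 1} := by
  set p := toQs R k with hp
  set q := toQs R l with hq
  have main : ∀ f : Qs R →ₗ[C] C, span C {q, 1} ≤ LinearMap.ker f →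
      f (q * q) = 0 ∧ f (p * q) = 0 := by
    intro f hf
    have hfq : f q = 0 := hf (subset_span (by simp))
    have hf1 : f 1 = 0 := hf (subset_span (by simp))
    -- These are the coefficients of `[k,l][l,x] - [k,[l,x]]l = 0`. As `f` kills 1 and `l`, what
    -- survives is `f(l²)k + f(kl)l - f(lkl) = 0`.
    have h := sum_apply_right_smul_eq_zero
      ![(p * q - q * p) * q, -((p * q - q * p) + p * q), p, q, -1] ![1, q, q * q, p * q, q * p * q]
      (fun x => by
        have := congrArg (toQs R) (commutator_mul_eq_commutator_mul hK hL hKL hk hl (hL l hl x))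
        simp only [map_mul, map_sub, ← hp, ← hq] at this
        rw [← sub_eq_zero] at this
        rw [Fin.sum_univ_five, ← this]
        simp only [Matrix.cons_val]
        noncomm_ring) f
    rw [Fin.sum_univ_five] at h
    simp only [Matrix.cons_val, hfq, hf1, zero_smul, zero_add] at h
    refine coeff_eq_zero hl1 hkl (γ := -f (q * p * q)) ?_
    rw [← h, smul_neg, neg_smul]
  constructor
  · by_contra hc
    obtain ⟨f, hf, hfk⟩ := exists_le_ker_of_notMem hc
    exact hf (main f hfk).1
  · by_contra hc
    obtain ⟨f, hf, hfk⟩ := exists_le_ker_of_notMem hc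
    exact hf (main f hfk).2

open Submodule in
theorem mul_mem_span_left {k l : R} (hk : k ∈ K) (hl : l ∈ L)
    (hk1 : toQs R k ∉ span C {1}) (hlk : toQs R l ∉ span C {toQs R k, 1}) :
    toQs R k * toQs R l ∈ span C {toQs R k, 1} := by
  set p := toQs R k with hp
  set q := toQs R l with hq
  by_contra hc
  obtain ⟨f, hf, hfk⟩ := exists_le_ker_of_notMem hc
  have hfp : f p = 0 := hfk (subset_span (by simp))
  have hf1 : f 1 = 0 := hfk (subset_span (by simp))
  -- These are the coefficients of `k[l,[k,x]] - [k,x][l,k] = 0`, sorted by their left factors.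
  have h := sum_apply_left_smul_eq_zero
    ![p * q * p, -(p * q), -(p * p), p, -p, 1]
    ![1, p, q, p * q, q * p - p * q, p * (q * p - p * q)]
    (fun x => by
      have := congrArg (toQs R) (mul_commutator_eq_mul_commutator hK hL hKL hk (hK k hk x) hl)
      simp only [map_mul, map_sub, ← hp, ← hq] at this
      rw [← sub_eq_zero] at this
      rw [Fin.sum_univ_six, ← this]
      simp only [Matrix.cons_val]
      noncomm_ring) f
  rw [Fin.sum_univ_six] at h
  simp only [Matrix.cons_val, hfp, hf1, zero_smul, map_neg, neg_zero, add_zero] at h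
  refine hf (neg_eq_zero.1 (coeff_eq_zero hk1 hlk (α := -f (p * p)) (γ := f (p * q * p)) ?_).2)
  rw [← h]
  abel

-- `kl` lies in both `Cl + C` and `Ck + C`, hence equals a scalar `α`. With `l² = tl + s`, computing
-- `kl²` in two ways gives `αl = tα + sk`, so `α = 0`.
open Submodule in
theorem mul_eq_zero_of_notMem_span {k l : R} (hk : k ∈ K) (hl : l ∈ L)
    (hl1 : toQs R l ∉ span C {1}) (hkl : toQs R k ∉ span C {toQs R l, 1}) : k * l = 0 := by
  have hk1 : toQs R k ∉ span C {1} := fun h =>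
    hkl (span_mono (Set.singleton_subset_iff.2 (by simp)) h)
  have hlk : toQs R l ∉ span C {toQs R k, 1} := fun h => hkl (mem_span_insert_exchange h hl1)
  obtain ⟨h1, h2⟩ := mul_mem_span_right hK hL hKL hk hl hl1 hkl
  obtain ⟨t, s, h1⟩ := mem_span_pair.1 h1
  obtain ⟨β, α, h2⟩ := mem_span_pair.1 h2
  obtain ⟨β', α', h3⟩ := mem_span_pair.1 (mul_mem_span_left hK hL hKL hk hl hk1 hlk)
  obtain ⟨-, hβ⟩ := coeff_eq_zero (α := -β') (β := β) (γ := α - α') hl1 hkl (by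
    rw [neg_smul, sub_smul, ← sub_eq_zero.2 (h2.trans h3.symm)]
    abel)
  rw [hβ, zero_smul, zero_add] at h2
  obtain ⟨-, hα⟩ := coeff_eq_zero (α := -s) (β := α) (γ := -(t * α)) hl1 hkl (by
    have h4 : toQs R k * toQs R l * toQs R l = toQs R k * (toQs R l * toQs R l) := mul_assoc _ _ _
    rw [← h1, ← h2, mul_add, mul_smul_comm, mul_smul_comm, ← h2, mul_one, smul_mul_assoc,
      one_mul] at h4
    rw [h4, neg_smul, neg_smul, mul_smul]
    abel)
  rw [← toQs_eq_zero, map_mul, ← h2, hα, zero_smul]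

open Submodule in
theorem mem_span_of_not_containsNonzeroIdeal {k l : R} (hk : k ∈ K) (hl : l ∈ L)
    (hl1 : toQs R l ∉ span C {1}) : toQs R k ∈ span C {toQs R l, 1} := by
  by_contra hkl
  have hKl : ∀ k' ∈ K, k' * l = 0 := by
    intro k' hk'
    by_cases h : toQs R k' ∈ span C {toQs R l, 1}
    -- Translating by `k` leaves the span, so both `(k + k')l` and `kl` vanish.
    · have h1 : toQs R (k + k') ∉ span C {toQs R l, 1} := by
        rw [map_add]
        exact fun h2 => hkl ((Submodule.add_mem_iff_left _ h).1 h2)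
      have := mul_eq_zero_of_notMem_span hK hL hKL (K.add_mem hk hk') hl hl1 h1
      rwa [add_mul, mul_eq_zero_of_notMem_span hK hL hKL hk hl hl1 hkl, zero_add] at this
    · exact mul_eq_zero_of_notMem_span hK hL hKL hk' hl hl1 h
  -- `[k,r] ∈ K` gives `0 = [k,r]l = krl`, since `kl = 0`.
  rcases IsPrimeRing.eq_zero_or_eq_zero k l fun r => by
    have := hKl _ (hK k hk r)
    rwa [sub_mul, mul_assoc r, hKl k hk, mul_zero, sub_zero] at this with h | h
  · exact hkl (by rw [h, map_zero]; exact zero_mem _)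
  · exact hl1 (by rw [h, map_zero]; exact zero_mem _)

end NoIdeal

end Main
end Martindale

/-! ### The spans `KC` and `LC` -/

namespace Martindale

section Main

variable {R : Type*} [NonUnitalRing R] [IsPrimeRing R] [Nontrivial R]

local notation "C" => extendedCentroid R

open Submodule

theorem smul_mem_centroidSpan (A : Set R) (c : C) {x : Qs R} (hx : x ∈ centroidSpan A) :
    c • x ∈ centroidSpan A := by
  induction hx using AddSubgroup.closure_induction with
  | mem x hx =>
    obtain ⟨a, ha, d, hd, rfl⟩ := hx
    have h : c • (a * d) = a * (c * d) := (mul_smul_comm c a d).symm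
    rw [h]
    exact mul_mem_addProd ha ((extendedCentroid R).mul_mem c.2 hd)
  | zero => simp
  | add x y _ _ hx hy => rw [smul_add]; exact add_mem hx hy
  | neg x _ hx => rw [smul_neg]; exact neg_mem hx

theorem centroidSpan_eq (A : Set R) :
    centroidSpan A = (span C (toQs R '' A)).toAddSubgroup := by
  refine le_antisymm (addProd_le ?_) fun x hx => ?_
  · rintro a ha c hc
    rw [← extendedCentroid_comm ⟨c, hc⟩]
    exact smul_mem _ (⟨c, hc⟩ : C) (subset_span ha)
  · rw [mem_toAddSubgroup] at hx
    induction hx using span_induction with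
    | mem a ha =>
      rw [← mul_one a]
      exact mul_mem_addProd ha (extendedCentroid R).one_mem
    | zero => exact zero_mem _
    | add x y _ _ hx hy => exact add_mem hx hy
    | smul c x _ hx => exact smul_mem_centroidSpan A c hx

theorem centroidLine_eq (a : R) :
    centroidLine a = (span C {toQs R a, 1}).toAddSubgroup := by
  refine le_antisymm (sup_le (addProd_le ?_) fun c hc => ?_) fun x hx => ?_
  · rintro c hc _ rfl
    exact smul_mem _ (⟨c, hc⟩ : C) (subset_span (by simp))
  · rw [← mul_one c]
    exact smul_mem _ (⟨c, hc⟩ : C) (subset_span (by simp))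
  · obtain ⟨c, d, rfl⟩ := mem_span_pair.1 ((mem_toAddSubgroup _).1 hx)
    refine AddSubgroup.add_mem_sup (mul_mem_addProd c.2 rfl) ?_
    change (d : Qs R) * 1 ∈ C
    rw [mul_one]
    exact d.2

omit [IsPrimeRing R] [Nontrivial R] in
theorem exists_commutator_ne_zero {m : R} (hm : m ∉ Set.center R) : ∃ r, m * r - r * m ≠ 0 := by
  by_contra! h
  exact hm (Semigroup.mem_center_iff.2 fun r => (sub_eq_zero.1 (h r)).symm)

/-- Needed to get 1 into the span of a Lie ideal. If `[a,r] = δ(r)a` for all `r`, then `[a,ar] =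
a[a,r]` gives `a² = γa`; next `a[a,r]a = 0` gives `a³ = 0`, hence `a² = 0`; then `a[a,s] = 0` gives
`asa = 0`, so `a = 0`. -/
theorem exists_commutator_notMem_span {m : R} (hm : m ∉ Set.center R) :
    ∃ r, toQs R (m * r - r * m) ∉ span C {toQs R m} := by
  by_contra! h
  simp only [mem_span_singleton] at h
  choose δ hδ using h
  set a := toQs R m with ha
  obtain ⟨r, hr⟩ := exists_commutator_ne_zero hm
  have hδr : δ r ≠ 0 := fun h0 => hr (by rw [← toQs_eq_zero, ← hδ, h0, zero_smul])
  have h1 : δ (m * r) • a = δ r • (a * a) := by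
    rw [hδ, ← mul_smul_comm, hδ, ← map_mul]
    congr 1
    noncomm_ring
  have h2 : a * a = ((δ r)⁻¹ * δ (m * r)) • a := by
    rw [mul_smul, h1, smul_smul, inv_mul_cancel₀ hδr, one_smul]
  set γ := (δ r)⁻¹ * δ (m * r)
  have h3 : δ r • (a * a * a) = 0 := by
    have : a * (δ r • a) * a = (a * a) * toQs R r * a - a * toQs R r * (a * a) := by
      rw [hδ, map_sub, map_mul, map_mul]
      noncomm_ring
    rw [← smul_mul_assoc, ← mul_smul_comm, this, h2, smul_mul_assoc, smul_mul_assoc,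
      mul_smul_comm, sub_self]
  have h4 : a * a = 0 := by
    have h5 := (smul_eq_zero.1 h3).resolve_left hδr
    nth_rw 1 [h2] at h5
    rw [smul_mul_assoc] at h5
    rcases smul_eq_zero.1 h5 with h5 | h5
    · rw [h2, h5, zero_smul]
    · exact h5
  have h6 : a = 0 := by
    refine (eq_zero_or_eq_zero_of_toQs (p := a) (q := a) fun s => ?_).elim id id
    have : a * (δ s • a) = (a * a) * toQs R s - a * toQs R s * a := by
      rw [hδ, map_sub, map_mul, map_mul]
      noncomm_ring
    rw [mul_smul_comm, h4, smul_zero, zero_mul, zero_sub] at this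
    exact neg_eq_zero.1 this.symm
  exact hr (by rw [toQs_eq_zero.1 h6, zero_mul, mul_zero, sub_zero])

theorem span_eq_span_pair {M : AddSubgroup R} (hM : IsLieIdeal M) {m : R} (hm : m ∈ M)
    (hmc : m ∉ Set.center R) (h : ∀ x ∈ M, toQs R x ∈ span C {toQs R m, 1}) :
    span C (toQs R '' M) = span C {toQs R m, 1} := by
  refine le_antisymm (span_le.2 (Set.image_subset_iff.2 h)) (span_le.2 ?_)
  have hmM : toQs R m ∈ span C (toQs R '' M) := subset_span ⟨m, hm, rfl⟩
  refine Set.insert_subset hmM (Set.singleton_subset_iff.2 ?_)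
  obtain ⟨r, hr⟩ := exists_commutator_notMem_span hmc
  have h1 := h _ (hM m hm r)
  rw [Set.pair_comm] at h1
  have hle : span C {toQs R (m * r - r * m), toQs R m} ≤ span C (toQs R '' M) :=
    span_le.2 (Set.insert_subset (subset_span ⟨_, hM m hm r, rfl⟩)
      (Set.singleton_subset_iff.2 hmM))
  -- `[m,r] ∈ Cm + C` but not in `Cm`, so 1 can be exchanged for `[m,r]`.
  exact hle (mem_span_insert_exchange h1 hr)

theorem commute_of_mem_span_pair {a x : Qs R} (h : x ∈ span C {a, 1}) : x * a = a * x := by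
  obtain ⟨c, d, rfl⟩ := mem_span_pair.1 h
  simp only [add_mul, mul_add, smul_mul_assoc, mul_smul_comm, one_mul, mul_one]

/-- For `x ∈ I`, `xra = axr = xar`, so `I` annihilates `[r,a]`. -/
theorem mem_center_of_forall_mul_commute {I : TwoSidedIdeal R} (hI : I ≠ ⊥) {a : R}
    (h : ∀ x ∈ I, x * a = a * x) : a ∈ Set.center R := by
  refine Semigroup.mem_center_iff.2 fun r => ?_
  rw [← sub_eq_zero, ← toQs_eq_zero]
  refine eq_zero_of_toQs_mul hI fun x hx => ?_
  rw [← map_mul, toQs_eq_zero, mul_sub, ← mul_assoc, ← mul_assoc, h _ (I.mul_mem_right _ _ hx),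
    h x hx, mul_assoc, sub_self]

end Main
end Martindale

open Martindale Submodule in
theorem mainTheorem12 {R : Type*} [NonUnitalRing R] [IsPrimeRing R] [Nontrivial R]
    (K L : AddSubgroup R) (hK : IsLieIdeal K) (hL : IsLieIdeal L)
    (hKc : ¬ (K : Set R) ⊆ Set.center R) (hLc : ¬ (L : Set R) ⊆ Set.center R) :
    ContainsNonzeroIdeal (addProd (K : Set R) (L : Set R)) ↔
      ¬ ∃ a ∈ L, Martindale.centroidSpan (K : Set R) = Martindale.centroidSpan (L : Set R) ∧
        Martindale.centroidSpan (L : Set R) = Martindale.centroidLine a := by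
  simp only [centroidSpan_eq, centroidLine_eq, toAddSubgroup_inj]
  constructor
  · rintro ⟨I, hI, hIKL⟩ ⟨a, -, hKL, hLa⟩
    have hLmem : ∀ l ∈ L, toQs R l ∈ span (extendedCentroid R) {toQs R a, 1} := fun l hl => by
      rw [← hLa]
      exact subset_span ⟨l, hl, rfl⟩
    have hKmem : ∀ k ∈ K, toQs R k ∈ span (extendedCentroid R) {toQs R a, 1} := fun k hk => by
      rw [← hLa, ← hKL]
      exact subset_span ⟨k, hk, rfl⟩
    have hcomm : ∀ x, toQs R x ∈ span (extendedCentroid R) {toQs R a, 1} → x * a = a * x :=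
      fun x hx => toQs_injective R (by rw [map_mul, map_mul, commute_of_mem_span_pair hx])
    have hKLa : ∀ x ∈ addProd (K : Set R) (L : Set R), x * a = a * x := fun x hx => by
      induction hx using AddSubgroup.closure_induction with
      | mem x hx =>
        obtain ⟨k, hk, l, hl, rfl⟩ := hx
        rw [mul_assoc, hcomm l (hLmem l hl), ← mul_assoc, hcomm k (hKmem k hk), mul_assoc]
      | zero => rw [zero_mul, mul_zero]
      | add x y _ _ hx hy => rw [add_mul, mul_add, hx, hy]
      | neg x _ hx => rw [neg_mul, mul_neg, hx]
    have ha : a ∈ Set.center R := mem_center_of_forall_mul_commute hI fun x hx => hKLa x (hIKL hx)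
    refine hLc fun l hl => Semigroup.mem_center_iff.2 fun r => toQs_injective R ?_
    obtain ⟨c, d, hcd⟩ := mem_span_pair.1 (hLmem l hl)
    rw [map_mul, map_mul, ← hcd]
    simp only [mul_add, add_mul, mul_smul_comm, smul_mul_assoc, mul_one, one_mul, ← map_mul,
      Semigroup.mem_center_iff.1 ha r]
  · intro h
    by_contra hKL
    obtain ⟨k, hk, hkc⟩ := Set.not_subset.1 hKc
    obtain ⟨l, hl, hlc⟩ := Set.not_subset.1 hLc
    have hl1 := notMem_span_one hlc
    have hKl : ∀ k ∈ K, toQs R k ∈ span (extendedCentroid R) {toQs R l, 1} := fun k hk =>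
      mem_span_of_not_containsNonzeroIdeal hK hL hKL hk hl hl1
    have hkl : span (extendedCentroid R) {toQs R k, 1} = span _ {toQs R l, 1} :=
      le_antisymm
        (span_le.2 (Set.insert_subset (hKl k hk) (Set.singleton_subset_iff.2 (subset_span (by simp)))))
        (span_le.2 (Set.insert_subset (mem_span_insert_exchange (hKl k hk) (notMem_span_one hkc))
          (Set.singleton_subset_iff.2 (subset_span (by simp)))))
    have hKspan := (span_eq_span_pair hK hk hkc fun x hx => by rw [hkl]; exact hKl x hx).trans hkl
    have hLspan := span_eq_span_pair hL hl hlc fun x hx => ?_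
    · exact h ⟨l, hl, hKspan.trans hLspan.symm, hLspan⟩
    rw [← hkl]
    -- A nonscalar `x ∈ L` can itself play the role of `l`: `k ∈ Cx + C`, and exchange gives `x ∈ Ck
    -- + C`.
    by_cases hx1 : toQs R x ∈ span (extendedCentroid R) {1}
    · exact span_mono (Set.singleton_subset_iff.2 (by simp)) hx1
    · exact mem_span_insert_exchange
        (mem_span_of_not_containsNonzeroIdeal hK hL hKL hk hx hx1) (notMem_span_one hkc)
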